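/- Let $N\ge 2$ qubits be governed by the non-interacting Hamiltonian $H=\sum_{l=1}^N I\otimes\cdots\otimes H_l\otimes\cdots\otimes I$ with $H_l=\sum_{i=0}^{1}(E_l+i\alpha_l)|i\rangle\langle i|$, where $E_l\in\mathbb R$ and $\alpha_l\ge 0$. Let $X$ be a set of $\kappa$ of the qubits, $1\le\kappa\le N-1$, let $X^c$ be the set of the remaining qubits, and let $H_X,H_{X^c}$ be the sums of the one-qubit Hamiltonians over $X$ and $X^c$, acting on the Hilbert spaces of $X$ and of $X^c$. Put $E_g=\sum_{l=1}^N E_l$, $E_g^X=\sum_{l\in X}E_l$, $E_g^{X^c}=\sum_{l\in X^c}E_l$. Let $E_g+n_j$ $(0\le j\le 2^N-1)$ be the eigenvalues of $H$ and $E_g^X+m_j$ $(0\le j\le 2^\kappa-1)$ those of $H_X$, with multiplicity and in increasing order. For a state $\rho$ of the $N$ qubits with marginals $\rho_X=\operatorname{Tr}_{X^c}\rho$ and $\rho_{X^c}=\operatorname{Tr}_X\rho$, let $W(\rho)=\operatorname{Tr}[\rho H]-\min_U\operatorname{Tr}[U\rho U^\dagger H]$ and $W_{[\kappa]}(\rho_X)=\operatorname{Tr}[\rho_XH_X]-\min_V\operatorname{Tr}[V\rho_XV^\dagger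 H_X]$ be the global and local ergotropies ($U$, $V$ range over all unitaries on the respective spaces), and let $$\Delta_{X|X^c}=W(\rho)-W_{[\kappa]}(\rho_X)-\operatorname{Tr}[\rho_{X^c}H_{X^c}]+E_g^{X^c}.$$ Let $t_0\ge t_1\ge\cdots\ge t_{2^N-1}$ and $x_0\ge\cdots\ge x_{2^\kappa-1}$ be the eigenvalues, with multiplicity, of $\rho$ and of $\rho_X$. If $\rho$ is separable across $X$-vs-$X^c$, that is, $\rho=\sum_i p_i\,|\psi_i\rangle\langle\psi_i|\otimes|\phi_i\rangle\langle\phi_i|$ for a finite probability distribution $(p_i)$ and unit vectors $\psi_i$ of $X$ and $\phi_i$ of $X^c$, then $$\Delta_{X|X^c}\le\delta^{GL}_{X|X^c}:=\sum_{i=1}^{2^\kappa-1}(m_i-m_1)x_i+\sum_{i=1}^{2^N-1}(m_1-n_i)t_i,$$ $$\Delta_{X|X^c}\le\delta^{G}_{X|X^c}:=\sum_{i=1}^{2^\kappa-2}(m_i-n_i)t_i+\sum_{i=2^\kappa-1}^{2^N-1}(m_{2^\kappa-1}-n_i)t_i,$$ where $m_{2^\kappa-1}=\sum_{l\in X}\alpha_l$.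 -/

import Mathlib

open Matrix
open scoped Kronecker ComplexOrder

noncomputable section

namespace QubitErgotropy

/-- Labels of the computational (energy) product basis of the qubits in `ι`. The Hilbert space
`⨂_{l ∈ ι} ℂ²` has this set as its standard basis, and operators on it are matrices over it. -/
abbrev Config (ι : Type) : Type := ι → Fin 2

/-- Operators on the Hilbert space of the qubits in `ι`. -/
abbrev Op (ι : Type) : Type := Matrix (Config ι) (Config ι) ℂ

/-- The tensor product `⨂_l A_l` of one-qubit operators. -/
def tensorOp {ι : Type} [Fintype ι] (A : ι → Matrix (Fin 2) (Fin 2) ℂ) : Op ι :=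
  Matrix.of fun s t => ∏ l, A l (s l) (t l)

/-- The one-qubit Hamiltonian `∑_{i=0,1} (E + i α) |i⟩⟨i|`. -/
def qubitHamiltonian (E α : ℝ) : Matrix (Fin 2) (Fin 2) ℂ :=
  Matrix.diagonal fun i => ((E + (i : ℕ) * α : ℝ) : ℂ)

/-- The non-interacting Hamiltonian `∑_l I ⊗ ⋯ ⊗ H_l ⊗ ⋯ ⊗ I`. -/
def hamiltonian {ι : Type} [Fintype ι] [DecidableEq ι] (E α : ι → ℝ) : Op ι :=
  ∑ l, tensorOp (Function.update (fun _ => 1) l (qubitHamiltonian (E l) (α l)))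

/-- A density operator: positive semidefinite with trace one. -/
structure State (ι : Type) [Fintype ι] [DecidableEq ι] where
  /-- the matrix of the operator -/
  mat : Op ι
  posSemidef : mat.PosSemidef
  trace_eq_one : mat.trace = 1

/-- The mean energy `Tr[ρ H]` (a real number, since both factors are Hermitian). -/
def energy {ι : Type} [Fintype ι] [DecidableEq ι] (H ρ : Op ι) : ℝ :=
  (ρ * H).trace.re

/-- `min_U Tr[U ρ U† H]` over all unitaries `U`; the infimum is attained, see `minEnergy_isLeast`. -/
def minEnergy {ι : Type} [Fintype ι] [DecidableEq ι] (H ρ : Op ι) : ℝ :=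
  ⨅ U : Matrix.unitaryGroup (Config ι) ℂ,
    energy H ((U : Op ι) * ρ * (U : Op ι)ᴴ)

/-- The ergotropy `Tr[ρ H] - min_U Tr[U ρ U† H]`. -/
def ergotropy {ι : Type} [Fintype ι] [DecidableEq ι] (H : Op ι) (ρ : State ι) : ℝ :=
  energy H ρ.mat - minEnergy H ρ.mat

/-- The unitaries form a compact set, so the minimum over them exists. -/
theorem minEnergy_isLeast {ι : Type} [Fintype ι] [DecidableEq ι] (H ρ : Op ι) :
    IsLeast (Set.range fun U : Matrix.unitaryGroup (Config ι) ℂ =>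
      energy H ((U : Op ι) * ρ * (U : Op ι)ᴴ)) (minEnergy H ρ) := by
  have hclosed : IsClosed {U : Op ι | U ∈ Matrix.unitaryGroup (Config ι) ℂ} := by
    simp only [Matrix.mem_unitaryGroup_iff]
    exact isClosed_eq (by fun_prop) continuous_const
  have hb : IsCompact {U : Op ι | ∀ i, ∀ j, U i j ∈ Metric.closedBall (0 : ℂ) 1} := by
    have h := isCompact_pi_infinite fun _ : Config ι =>
      isCompact_pi_infinite fun _ : Config ι => isCompact_closedBall (0 : ℂ) 1
    exact h
  have hcomp : IsCompact {U : Op ι | U ∈ Matrix.unitaryGroup (Config ι) ℂ} := by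
    refine IsCompact.of_isClosed_subset hb hclosed ?_
    intro U hU i j
    rw [mem_closedBall_zero_iff]
    exact entry_norm_bound_of_unitary hU i j
  have hcont : Continuous fun U : Op ι => energy H (U * ρ * Uᴴ) := by
    have h1 : Continuous fun U : Op ι => U * ρ * Uᴴ * H :=
      (((continuous_id.matrix_mul continuous_const).matrix_mul
        continuous_id.matrix_conjTranspose).matrix_mul continuous_const)
    exact Complex.continuous_re.comp h1.matrix_trace
  obtain ⟨U, hU, hmin⟩ := hcomp.exists_isMinOn ⟨(1 : Op ι), one_mem (Matrix.unitaryGroup (Config ι) ℂ)⟩ hcont.continuousOn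
  have hmin' := isMinOn_iff.1 hmin
  have hle : ∀ V : Matrix.unitaryGroup (Config ι) ℂ,
      energy H (U * ρ * Uᴴ) ≤ energy H ((V : Op ι) * ρ * (V : Op ι)ᴴ) := fun V => hmin' V V.2
  have h1 : minEnergy H ρ = energy H (U * ρ * Uᴴ) :=
    le_antisymm (ciInf_le ⟨_, Set.forall_mem_range.2 hle⟩ (⟨U, hU⟩ : Matrix.unitaryGroup _ ℂ))
      (le_ciInf hle)
  rw [h1]
  exact ⟨Set.mem_range.2 ⟨⟨U, hU⟩, rfl⟩, Set.forall_mem_range.2 hle⟩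

/-- The eigenvalues of a Hermitian matrix, with multiplicity, in decreasing order:
`decrEig hA 0 ≥ decrEig hA 1 ≥ ⋯`. Only indices below the size of the matrix matter. -/
def decrEig {n : Type} [Fintype n] [DecidableEq n] {A : Matrix n n ℂ} (hA : A.IsHermitian)
    (j : ℕ) : ℝ :=
  if h : j < Fintype.card n then hA.eigenvalues₀ ⟨j, h⟩ else 0

/-- The eigenvalues of a Hermitian matrix, with multiplicity, in increasing order:
`incrEig hA 0 ≤ incrEig hA 1 ≤ ⋯`. Only indices below the size of the matrix matter. -/
def incrEig {n : Type} [Fintype n] [DecidableEq n] {A : Matrix n n ℂ} (hA : A.IsHermitian)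
    (j : ℕ) : ℝ :=
  if h : j < Fintype.card n then hA.eigenvalues₀ (Fin.rev ⟨j, h⟩) else 0

theorem decrEig_anti {n : Type} [Fintype n] [DecidableEq n] {A : Matrix n n ℂ}
    (hA : A.IsHermitian) {j k : ℕ} (hjk : j ≤ k) (hk : k < Fintype.card n) :
    decrEig hA k ≤ decrEig hA j := by
  rw [decrEig, decrEig, dif_pos hk, dif_pos (hjk.trans_lt hk)]
  exact hA.eigenvalues₀_antitone hjk

theorem incrEig_mono {n : Type} [Fintype n] [DecidableEq n] {A : Matrix n n ℂ}
    (hA : A.IsHermitian) {j k : ℕ} (hjk : j ≤ k) (hk : k < Fintype.card n) :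
    incrEig hA j ≤ incrEig hA k := by
  rw [incrEig, incrEig, dif_pos hk, dif_pos (hjk.trans_lt hk)]
  exact hA.eigenvalues₀_antitone (Fin.rev_le_rev.2 hjk)

theorem hamiltonian_isHermitian {ι : Type} [Fintype ι] [DecidableEq ι] (E α : ι → ℝ) :
    (hamiltonian E α).IsHermitian := by
  ext s t
  simp only [hamiltonian, tensorOp, Matrix.conjTranspose_apply, Matrix.sum_apply, Matrix.of_apply,
    star_sum, star_prod]
  refine Finset.sum_congr rfl fun l _ => Finset.prod_congr rfl fun k _ => ?_
  rcases eq_or_ne k l with rfl | h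
  · simp only [Function.update_self, qubitHamiltonian, Matrix.diagonal_apply]
    by_cases hst : s k = t k <;> simp [hst, eq_comm]
  · simp only [Function.update_of_ne h, Matrix.one_apply]
    by_cases hst : s k = t k <;> simp [hst, eq_comm]

/-- The ground energy `E_g = ∑_l E_l`. -/
def groundEnergy {ι : Type} [Fintype ι] (E : ι → ℝ) : ℝ := ∑ l, E l

/-- The sorted energy gaps: the `j`-th smallest energy eigenvalue is `E_g + gap E α j`. -/
def gap {ι : Type} [Fintype ι] [DecidableEq ι] (E α : ι → ℝ) (j : ℕ) : ℝ :=
  incrEig (hamiltonian_isHermitian E α) j - groundEnergy E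

/-- The spectrum of a state, in decreasing order. -/
def State.spec {ι : Type} [Fintype ι] [DecidableEq ι] (ρ : State ι) (j : ℕ) : ℝ :=
  decrEig ρ.posSemidef.isHermitian j

section Bipartition

variable {ι : Type} [Fintype ι] [DecidableEq ι]

/-- The identification of the basis of all qubits with pairs of basis labels of `X` and `X^c`. -/
def split (X : Finset ι) : Config ι ≃ Config {l // l ∈ X} × Config {l // l ∉ X} :=
  Equiv.piEquivPiSubtypeProd (fun l => l ∈ X) (fun _ => Fin 2)

/-- The marginal `ρ_X = Tr_{X^c} ρ`. -/
def State.marginal (ρ : State ι) (X : Finset ι) : State {l // l ∈ X} where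
  mat := ∑ c, ρ.mat.submatrix (fun a => (split X).symm (a, c)) (fun a => (split X).symm (a, c))
  posSemidef := Matrix.posSemidef_sum _ fun _ _ => ρ.posSemidef.submatrix _
  trace_eq_one := by
    rw [← ρ.trace_eq_one, Matrix.trace_sum]
    simp only [Matrix.trace, Matrix.diag_apply, Matrix.submatrix_apply]
    rw [← Equiv.sum_comp (split X).symm, Fintype.sum_prod_type_right]

/-- The marginal `ρ_{X^c} = Tr_X ρ`. -/
def State.marginalCompl (ρ : State ι) (X : Finset ι) : State {l // l ∉ X} where
  mat := ∑ a, ρ.mat.submatrix (fun c => (split X).symm (a, c)) (fun c => (split X).symm (a, c))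
  posSemidef := Matrix.posSemidef_sum _ fun _ _ => ρ.posSemidef.submatrix _
  trace_eq_one := by
    rw [← ρ.trace_eq_one, Matrix.trace_sum]
    simp only [Matrix.trace, Matrix.diag_apply, Matrix.submatrix_apply]
    rw [← Equiv.sum_comp (split X).symm, Fintype.sum_prod_type]

/-- The projector `|ψ⟩⟨ψ|`. -/
def proj {n : Type} (ψ : n → ℂ) : Matrix n n ℂ := Matrix.vecMulVec ψ (star ψ)

/-- Separability across `X`-vs-`X^c`: a finite probabilistic mixture
`∑_i p_i |ψ_i⟩⟨ψ_i| ⊗ |φ_i⟩⟨φ_i|` of product states of unit vectors of `X` and of `X^c`. -/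
def State.IsSeparableAcross (ρ : State ι) (X : Finset ι) : Prop :=
  ∃ (k : ℕ) (p : Fin k → ℝ) (ψ : Fin k → Config {l // l ∈ X} → ℂ)
    (φ : Fin k → Config {l // l ∉ X} → ℂ),
    (∀ i, 0 ≤ p i) ∧ ∑ i, p i = 1 ∧
    (∀ i, ∑ a, ‖ψ i a‖ ^ 2 = 1) ∧ (∀ i, ∑ c, ‖φ i c‖ ^ 2 = 1) ∧
    ρ.mat = ∑ i, (p i : ℂ) • (proj (ψ i) ⊗ₖ proj (φ i)).submatrix (split X) (split X)

/-- `Δ_{X|X^c} = W(ρ) - W_{[κ]}(ρ_X) - E(ρ_{X^c}) + E_g^{X^c}`. -/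
def workDifference (E α : ι → ℝ) (X : Finset ι) (ρ : State ι) : ℝ :=
  ergotropy (hamiltonian E α) ρ
    - ergotropy (hamiltonian (fun l : {l // l ∈ X} => E l) (fun l => α l)) (ρ.marginal X)
    - energy (hamiltonian (fun l : {l // l ∉ X} => E l) (fun l => α l)) (ρ.marginalCompl X).mat
    + groundEnergy (fun l : {l // l ∉ X} => E l)

end Bipartition

end QubitErgotropy

end

/-! Without interactions the mean energy of `ρ` is the sum of its two local energies, so all mean
energies cancel from Δ. The minimal energies that remain are those of passive states (Birkhoff and
rearrangement, `minEnergy_eq_sum`), and Δ = ∑ mᵢ xᵢ - ∑ nᵢ tᵢ exactly (`workDifference_eq`).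

Separability enters only through majorization: the partial sums of `t` are at most those of `x`
(`State.IsSeparableAcross.sum_spec_le`). This follows from the reduction criterion ρ ≤ ρ_X ⊗ 1. In
an eigenbasis of ρ_X, let w_jk be the weight of the j-th eigenvector g_j of ρ on the k-th block, and
put D_jk = t_j w_jk / x_k. Then t = D x. The column sums of D are at most 1 because ∑_j t_j w_jk =
x_k; the row sums are at most 1 by testing the criterion on (ρ_X ⊗ 1)⁻¹ g_j.

The first bound exceeds Δ by exactly m₁ (x₀ - t₀), so it needs only t₀ ≤ x₀. The second is Abel
summation of ∑ mᵢ (xᵢ - tᵢ) and uses all the partial sums. -/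

namespace QubitErgotropy

/-! ### Inequalities for finite real sums -/

section RealSums

/-- Weights in `[0, 1]` of total at most `K` collect at most the sum of the `K` largest terms. -/
theorem sum_mul_le_sum_range_of_weights {d K : ℕ} (hK : K ≤ d) {x q : ℕ → ℝ}
    (hx : ∀ j k, j ≤ k → k < d → x k ≤ x j) (hx0 : ∀ k, k < d → 0 ≤ x k)
    (hq0 : ∀ k, k < d → 0 ≤ q k) (hq1 : ∀ k, k < d → q k ≤ 1)
    (hq : ∑ k ∈ Finset.range d, q k ≤ K) :
    ∑ k ∈ Finset.range d, x k * q k ≤ ∑ k ∈ Finset.range K, x k := by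
  rcases Nat.eq_zero_or_pos K with rfl | hKpos
  · have hz : ∀ k ∈ Finset.range d, q k = 0 :=
      (Finset.sum_eq_zero_iff_of_nonneg fun k hk => hq0 k (Finset.mem_range.1 hk)).1
        (le_antisymm (by simpa using hq)
          (Finset.sum_nonneg fun k hk => hq0 k (Finset.mem_range.1 hk)))
    rw [Finset.sum_eq_zero fun k hk => by rw [hz k hk, mul_zero]]
    simp
  · have hfilter : (Finset.range d).filter (· < K) = Finset.range K := by
      ext k; simp only [Finset.mem_filter, Finset.mem_range]; omega
    -- Compare with the threshold value `x (K - 1)`: both (x_k - x_{K-1})(1 - q_k) for k < K and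
    -- (x_{K-1} - x_k) q_k for k ≥ K are nonnegative. The corrections add up to x_{K-1} (K - ∑ q) ≥
    -- 0.
    have hpt : ∀ k ∈ Finset.range d, x k * q k ≤
        (if k < K then x k else 0) - x (K - 1) * ((if k < K then 1 else 0) - q k) := by
      intro k hk
      have hkd := Finset.mem_range.1 hk
      split_ifs with h
      · nlinarith [hx k (K - 1) (by omega) (by omega), hq1 k hkd]
      · nlinarith [hx (K - 1) k (by omega) hkd, hq0 k hkd]
    refine (Finset.sum_le_sum hpt).trans ?_
    rw [Finset.sum_sub_distrib, ← Finset.mul_sum, Finset.sum_sub_distrib, ← Finset.sum_filter,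
      ← Finset.sum_filter, hfilter, Finset.sum_const, Finset.card_range, nsmul_eq_mul, mul_one]
    nlinarith [mul_nonneg (hx0 (K - 1) (by omega)) (sub_nonneg.2 hq)]

/-- Abel summation: a sequence with nonnegative partial sums, weighted increasingly. -/
theorem sum_mul_le_mul_sum_of_monotone {m y : ℕ → ℝ} (K : ℕ)
    (hm : ∀ j, j < K → m j ≤ m (j + 1))
    (hy : ∀ j, j ≤ K → 0 ≤ ∑ i ∈ Finset.range j, y i) :
    ∑ i ∈ Finset.range (K + 1), m i * y i ≤ m K * ∑ i ∈ Finset.range (K + 1), y i := by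
  induction K with
  | zero => simp
  | succ K ih =>
    rw [Finset.sum_range_succ, Finset.sum_range_succ (n := K + 1)]
    nlinarith [ih (fun j hj => hm j (by omega)) (fun j hj => hy j (by omega)),
      mul_nonneg (sub_nonneg.2 (hm K (by omega))) (hy (K + 1) le_rfl)]

/-- Averaging an antivarying pair over a doubly stochastic matrix can only increase the sum of
products. -/
theorem sum_mul_le_of_doublyStochastic {n : Type*} [Fintype n] [DecidableEq n] {f g : n → ℝ}
    (hfg : Antivary f g) {S : Matrix n n ℝ} (hS : S ∈ doublyStochastic ℝ n) :
    ∑ i, f i * g i ≤ ∑ i, ∑ j, f i * S i j * g j := by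
  -- Birkhoff reduces the claim to permutation matrices, where it is the rearrangement inequality.
  obtain ⟨w, hw0, hw1, rfl⟩ := exists_eq_sum_perm_of_mem_doublyStochastic hS
  have hexp : ∑ i, ∑ j, f i * (∑ σ, w σ • σ.permMatrix ℝ) i j * g j
      = ∑ σ, w σ * ∑ i, f i * g (σ i) := by
    simp only [Matrix.sum_apply, Matrix.smul_apply, smul_eq_mul, Finset.mul_sum, Finset.sum_mul]
    rw [Finset.sum_comm' (t' := Finset.univ) (s' := fun _ => Finset.univ) (by simp)]
    rw [Finset.sum_congr rfl fun j _ => Finset.sum_comm, Finset.sum_comm]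
    refine Finset.sum_congr rfl fun σ _ => ?_
    rw [Finset.sum_comm]
    refine Finset.sum_congr rfl fun i _ => ?_
    rw [Finset.sum_eq_single (σ i)]
    · simp [Equiv.Perm.permMatrix, PEquiv.toMatrix_apply]
      ring
    · intro j _ hj
      simp [Equiv.Perm.permMatrix, PEquiv.toMatrix_apply, hj.symm]
    · simp
  rw [hexp]
  calc ∑ i, f i * g i = ∑ σ : Equiv.Perm n, w σ * ∑ i, f i * g i := by
        rw [← Finset.sum_mul, hw1, one_mul]
    _ ≤ _ := Finset.sum_le_sum fun σ _ =>
        mul_le_mul_of_nonneg_left hfg.sum_mul_le_sum_mul_comp_perm (hw0 σ)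

theorem sum_comp_equiv_fin_card {n : Type*} [Fintype n] (e : n ≃ Fin (Fintype.card n)) (f : ℕ → ℝ) :
    ∑ i, f (e i) = ∑ j ∈ Finset.range (Fintype.card n), f j := by
  rw [Finset.sum_range, Equiv.sum_comp e (fun j : Fin (Fintype.card n) => f j)]

end RealSums

/-! ### Diagonalization with sorted eigenvalues -/

section Spectral

variable {n : Type} [Fintype n] [DecidableEq n]

/-- The enumeration `e` is left free so that a state and a Hamiltonian can be diagonalized with the
same labels, one in decreasing and the other in increasing order. -/
theorem exists_unitary_diagonal_eigenvalues₀ {A : Matrix n n ℂ} (hA : A.IsHermitian)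
    (e : n ≃ Fin (Fintype.card n)) :
    ∃ V ∈ Matrix.unitaryGroup n ℂ,
      A = V * diagonal (fun i => (hA.eigenvalues₀ (e i) : ℂ)) * Vᴴ := by
  set e₀ : Fin (Fintype.card n) ≃ n := Fintype.equivOfCardEq (Fintype.card_fin _) with he₀
  set U : Matrix n n ℂ := (hA.eigenvectorUnitary : Matrix n n ℂ) with hU
  have hspec : A = U * diagonal (fun i => (hA.eigenvalues i : ℂ)) * Uᴴ := by
    have := hA.spectral_theorem
    rw [Unitary.conjStarAlgAut_apply] at this
    exact this
  have hev : ∀ i, hA.eigenvalues₀ (e i) = hA.eigenvalues ((e.trans e₀) i) := by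
    intro i
    simp [IsHermitian.eigenvalues, he₀]
  refine ⟨U.submatrix id (e.trans e₀), ?_, ?_⟩
  · rw [Matrix.mem_unitaryGroup_iff', star_eq_conjTranspose, conjTranspose_submatrix,
      ← Equiv.coe_refl, submatrix_mul_equiv]
    have := Matrix.mem_unitaryGroup_iff'.1 hA.eigenvectorUnitary.2
    rw [star_eq_conjTranspose] at this
    rw [this, submatrix_one_equiv]
  · have hd : diagonal (fun i => (hA.eigenvalues₀ (e i) : ℂ))
        = (diagonal (fun i => (hA.eigenvalues i : ℂ))).submatrix (e.trans e₀) (e.trans e₀) := by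
      rw [submatrix_diagonal_equiv]
      congr 1
      funext i
      rw [hev]; rfl
    rw [hd, conjTranspose_submatrix, submatrix_mul_equiv, submatrix_mul_equiv, ← hspec,
      submatrix_id_id]

theorem exists_unitary_diagonal_decrEig {A : Matrix n n ℂ} (hA : A.IsHermitian)
    (e : n ≃ Fin (Fintype.card n)) :
    ∃ V ∈ Matrix.unitaryGroup n ℂ, A = V * diagonal (fun i => (decrEig hA (e i) : ℂ)) * Vᴴ := by
  simpa [decrEig] using exists_unitary_diagonal_eigenvalues₀ hA e

theorem exists_unitary_diagonal_incrEig {A : Matrix n n ℂ} (hA : A.IsHermitian)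
    (e : n ≃ Fin (Fintype.card n)) :
    ∃ V ∈ Matrix.unitaryGroup n ℂ, A = V * diagonal (fun i => (incrEig hA (e i) : ℂ)) * Vᴴ := by
  simpa [incrEig] using exists_unitary_diagonal_eigenvalues₀ hA (e.trans Fin.revPerm)

theorem decrEig_nonneg {A : Matrix n n ℂ} (hA : A.PosSemidef) (j : ℕ) :
    0 ≤ decrEig hA.isHermitian j := by
  rw [decrEig]
  split_ifs with h
  · have := hA.eigenvalues_nonneg (Fintype.equivOfCardEq (Fintype.card_fin _) ⟨j, h⟩)
    simpa [IsHermitian.eigenvalues] using this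
  · exact le_rfl

theorem sum_decrEig {A : Matrix n n ℂ} (hA : A.IsHermitian) :
    ∑ j ∈ Finset.range (Fintype.card n), decrEig hA j = A.trace.re := by
  have e : n ≃ Fin (Fintype.card n) := Fintype.equivFin n
  obtain ⟨V, hV, h⟩ := exists_unitary_diagonal_decrEig hA e
  rw [← sum_comp_equiv_fin_card e]
  conv_rhs => rw [h]
  rw [Matrix.trace_mul_cycle, ← star_eq_conjTranspose,
    Matrix.mem_unitaryGroup_iff'.1 hV, one_mul, Matrix.trace_diagonal]
  simp

/-- The eigenvalues of a real diagonal matrix are its entries. -/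
theorem range_eigenvalues₀_diagonal {h : n → ℝ} {A : Matrix n n ℂ} (hA : A.IsHermitian)
    (hAh : A = diagonal fun i => (h i : ℂ)) : Set.range hA.eigenvalues₀ = Set.range h := by
  have h1 : Set.range hA.eigenvalues₀ = Set.range hA.eigenvalues := by
    have : hA.eigenvalues = hA.eigenvalues₀ ∘ (Fintype.equivOfCardEq (Fintype.card_fin _)).symm :=
      rfl
    rw [this, (Equiv.surjective _).range_comp]
  rw [h1, ← hA.spectrum_real_eq_range_eigenvalues]
  ext r
  rw [← spectrum.algebraMap_mem_iff ℂ, hAh, spectrum_diagonal]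
  simp

/-- Extreme eigenvalues depend only on the set of eigenvalues, so multiplicities need not be
tracked. -/
theorem incrEig_zero_diagonal {h : n → ℝ} {A : Matrix n n ℂ} (hA : A.IsHermitian)
    (hAh : A = diagonal fun i => (h i : ℂ)) {i₀ : n} (hi₀ : ∀ i, h i₀ ≤ h i) :
    incrEig hA 0 = h i₀ := by
  have hr := range_eigenvalues₀_diagonal hA hAh
  have hpos : 0 < Fintype.card n := Fintype.card_pos_iff.2 ⟨i₀⟩
  apply le_antisymm
  · obtain ⟨j, hj⟩ : h i₀ ∈ Set.range hA.eigenvalues₀ := hr ▸ Set.mem_range_self i₀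
    rw [← hj, incrEig, dif_pos hpos]
    exact hA.eigenvalues₀_antitone (Fin.le_rev_iff.2 (by simp [Fin.le_def]))
  · rw [incrEig, dif_pos hpos]
    obtain ⟨i, hi⟩ : hA.eigenvalues₀ (Fin.rev ⟨0, hpos⟩) ∈ Set.range h :=
      hr ▸ Set.mem_range_self _
    exact hi ▸ hi₀ i

theorem incrEig_last_diagonal {h : n → ℝ} {A : Matrix n n ℂ} (hA : A.IsHermitian)
    (hAh : A = diagonal fun i => (h i : ℂ)) {i₀ : n} (hi₀ : ∀ i, h i ≤ h i₀) :
    incrEig hA (Fintype.card n - 1) = h i₀ := by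
  have hr := range_eigenvalues₀_diagonal hA hAh
  have hpos : 0 < Fintype.card n := Fintype.card_pos_iff.2 ⟨i₀⟩
  have hlt : Fintype.card n - 1 < Fintype.card n := by omega
  rw [incrEig, dif_pos hlt]
  apply le_antisymm
  · obtain ⟨i, hi⟩ : hA.eigenvalues₀ (Fin.rev ⟨Fintype.card n - 1, hlt⟩) ∈ Set.range h :=
      hr ▸ Set.mem_range_self _
    exact hi ▸ hi₀ i
  · obtain ⟨j, hj⟩ : h i₀ ∈ Set.range hA.eigenvalues₀ := hr ▸ Set.mem_range_self i₀
    rw [← hj]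
    refine hA.eigenvalues₀_antitone ?_
    rw [Fin.le_def, Fin.val_rev]
    simp only
    omega

end Spectral

/-! ### Minimal energy over a unitary orbit -/

section MinEnergy

theorem trace_diagonal_conj {n : Type} [Fintype n] [DecidableEq n] (M : Matrix n n ℂ)
    (t h : n → ℝ) :
    (M * diagonal (fun i => (t i : ℂ)) * Mᴴ * diagonal (fun i => (h i : ℂ))).trace.re
      = ∑ i, ∑ j, t i * Complex.normSq (M j i) * h j := by
  rw [Finset.sum_comm]
  rw [Matrix.trace, Complex.re_sum]
  refine Finset.sum_congr rfl fun j _ => ?_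
  rw [Matrix.diag_apply, Matrix.mul_diagonal, Matrix.mul_apply, Finset.sum_mul, Complex.re_sum]
  refine Finset.sum_congr rfl fun i _ => ?_
  rw [Matrix.mul_diagonal, Matrix.conjTranspose_apply]
  have : M j i * (t i : ℂ) * star (M j i) * (h j : ℂ)
      = ((t i * Complex.normSq (M j i) * h j : ℝ) : ℂ) := by
    push_cast
    rw [← Complex.mul_conj, Complex.star_def]
    ring
  rw [this, Complex.ofReal_re]

theorem trace_conj_mul_conj {n : Type} [Fintype n] (U V W T D : Matrix n n ℂ) :
    (U * (V * T * Vᴴ) * Uᴴ * (W * D * Wᴴ)).trace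
      = (Wᴴ * U * V * T * (Wᴴ * U * V)ᴴ * D).trace := by
  rw [← Matrix.mul_assoc _ _ Wᴴ, Matrix.trace_mul_comm _ Wᴴ]
  simp only [Matrix.conjTranspose_mul, Matrix.conjTranspose_conjTranspose, Matrix.mul_assoc]

/-- Between the two eigenbases, `U` acts only through the squared moduli of the entries of `Wᴴ * U *
V`; for unitary matrices these form a doubly stochastic matrix. -/
theorem energy_conj_eq_sum {ι : Type} [Fintype ι] [DecidableEq ι] {H ρ V W : Op ι}
    {t h : Config ι → ℝ} (hρ : ρ = V * diagonal (fun i => (t i : ℂ)) * Vᴴ)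
    (hH : H = W * diagonal (fun i => (h i : ℂ)) * Wᴴ) (U : Op ι) :
    energy H (U * ρ * Uᴴ) = ∑ i, ∑ j, t i * Complex.normSq ((Wᴴ * U * V) j i) * h j := by
  rw [energy, hρ, hH, trace_conj_mul_conj]
  exact trace_diagonal_conj _ _ _

theorem normSq_unitary_mem_doublyStochastic {n : Type} [Fintype n] [DecidableEq n]
    {M : Matrix n n ℂ} (hM : M ∈ Matrix.unitaryGroup n ℂ) :
    (Matrix.of fun i j => Complex.normSq (M j i)) ∈ doublyStochastic ℝ n := by
  rw [mem_doublyStochastic_iff_sum]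
  refine ⟨fun i j => Complex.normSq_nonneg _, fun i => ?_, fun j => ?_⟩
  · have := congrFun (congrFun (Matrix.mem_unitaryGroup_iff'.1 hM) i) i
    simp only [star_eq_conjTranspose, Matrix.mul_apply, conjTranspose_apply, one_apply_eq,
      Complex.star_def, ← Complex.normSq_eq_conj_mul_self] at this
    exact_mod_cast this
  · have := congrFun (congrFun (Matrix.mem_unitaryGroup_iff.1 hM) j) j
    simp only [star_eq_conjTranspose, Matrix.mul_apply, conjTranspose_apply, one_apply_eq,
      Complex.star_def, Complex.mul_conj] at this
    exact_mod_cast this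

/-- The minimal energy over the unitary orbit is that of the passive state. -/
theorem minEnergy_eq_sum {ι : Type} [Fintype ι] [DecidableEq ι] {H ρ : Op ι}
    (hH : H.IsHermitian) (hρ : ρ.IsHermitian) :
    minEnergy H ρ
      = ∑ j ∈ Finset.range (Fintype.card (Config ι)), decrEig hρ j * incrEig hH j := by
  have e : Config ι ≃ Fin (Fintype.card (Config ι)) := Fintype.equivFin _
  obtain ⟨V, hV, hVρ⟩ := exists_unitary_diagonal_decrEig hρ e
  obtain ⟨W, hW, hWH⟩ := exists_unitary_diagonal_incrEig hH e
  rw [← sum_comp_equiv_fin_card e fun j => decrEig hρ j * incrEig hH j]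
  obtain ⟨⟨U, hU⟩, hmin⟩ := minEnergy_isLeast H ρ
  apply le_antisymm
  -- `W * Vᴴ` carries the eigenbasis of the state to that of `H`, larger populations to lower
  -- energies, so it produces the passive state.
  · have hWV : W * Vᴴ ∈ Matrix.unitaryGroup (Config ι) ℂ :=
      mul_mem hW (by rw [← star_eq_conjTranspose]; exact Unitary.star_mem hV)
    refine (hmin (Set.mem_range_self ⟨W * Vᴴ, hWV⟩)).trans_eq ?_
    refine (energy_conj_eq_sum hVρ hWH _).trans ?_
    have hone : Wᴴ * (W * Vᴴ) * V = 1 := by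
      have h1 := Matrix.mem_unitaryGroup_iff'.1 hW
      have h2 := Matrix.mem_unitaryGroup_iff'.1 hV
      rw [star_eq_conjTranspose] at h1 h2
      rw [← Matrix.mul_assoc, h1, one_mul, h2]
    rw [hone]
    refine Finset.sum_congr rfl fun i _ => ?_
    rw [Finset.sum_eq_single i]
    · simp
    · intro j _ hj
      simp [Matrix.one_apply_ne hj]
    · simp
  · rw [← hU]
    refine le_of_le_of_eq ?_ (energy_conj_eq_sum hVρ hWH U).symm
    refine sum_mul_le_of_doublyStochastic ?_ (normSq_unitary_mem_doublyStochastic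
      (mul_mem (mul_mem ?_ U.2) hV))
    · intro i j hij
      have hlt : e i < e j := by
        by_contra hle
        exact absurd (incrEig_mono hH (not_lt.1 hle) (e i).2) (not_le.2 hij)
      exact decrEig_anti hρ hlt.le (e j).2
    · rw [← star_eq_conjTranspose]; exact Unitary.star_mem hW

end MinEnergy

end QubitErgotropy

namespace QubitErgotropy

/-! ### Majorization of a global spectrum by a marginal spectrum -/

section Majorization

variable {A B J : Type} [Fintype A] [Fintype B] [Fintype J]

theorem star_dotProduct_conj_diagonal {n : Type} [Fintype n] [DecidableEq J] (G : Matrix n J ℂ)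
    (t : J → ℝ) (v : n → ℂ) :
    star v ⬝ᵥ ((G * diagonal (fun j => (t j : ℂ)) * Gᴴ) *ᵥ v)
      = ((∑ j, t j * Complex.normSq ((Gᴴ *ᵥ v) j) : ℝ) : ℂ) := by
  have h : star v ⬝ᵥ ((G * diagonal (fun j => (t j : ℂ)) * Gᴴ) *ᵥ v)
      = star (Gᴴ *ᵥ v) ⬝ᵥ (diagonal (fun j => (t j : ℂ)) *ᵥ (Gᴴ *ᵥ v)) := by
    rw [star_mulVec, conjTranspose_conjTranspose, ← dotProduct_mulVec, mulVec_mulVec,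
      mulVec_mulVec, Matrix.mul_assoc]
  rw [h, dotProduct]
  push_cast
  refine Finset.sum_congr rfl fun j _ => ?_
  rw [mulVec_diagonal, Pi.star_apply, Complex.normSq_eq_conj_mul_self, Complex.star_def]
  ring

/-- If `R = G diag(t) G†` on a bipartite space satisfies `R ≤ diag(x) ⊗ 1`, where `x` is the
diagonal of the first marginal of `R`, then `t` arises from `x` by a doubly substochastic
matrix. -/
theorem exists_substochastic_of_le_marginal [DecidableEq A] [DecidableEq B] [DecidableEq J]
    {R : Matrix (A × B) (A × B) ℂ} {G : Matrix (A × B) J ℂ} {t : J → ℝ} {x : A → ℝ}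
    (hG : Gᴴ * G = 1) (ht : ∀ j, 0 ≤ t j)
    (hR : R = G * diagonal (fun j => (t j : ℂ)) * Gᴴ)
    (hx : ∀ k, ∑ c, R (k, c) (k, c) = (x k : ℂ))
    (hle : (diagonal (fun p : A × B => (x p.1 : ℂ)) - R).PosSemidef) :
    ∃ D : J → A → ℝ, (∀ j k, 0 ≤ D j k) ∧ (∀ j, ∑ k, D j k ≤ 1) ∧ (∀ k, ∑ j, D j k ≤ 1) ∧
      ∀ j, ∑ k, x k * D j k = t j := by
  -- The weight of the j-th column of `G` on the block {k} × B.
  set w : J → A → ℝ := fun j k => ∑ c, Complex.normSq (G (k, c) j) with hw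
  have hw0 : ∀ j k, 0 ≤ w j k := fun j k =>
    Finset.sum_nonneg fun c _ => Complex.normSq_nonneg _
  have hw1 : ∀ j, ∑ k, w j k = 1 := by
    intro j
    have := congrFun (congrFun hG j) j
    simp only [Matrix.mul_apply, conjTranspose_apply, one_apply_eq,
      Complex.star_def, ← Complex.normSq_eq_conj_mul_self] at this
    rw [Fintype.sum_prod_type] at this
    exact_mod_cast this
  have hxw : ∀ k, ∑ j, t j * w j k = x k := by
    intro k
    have h1 : ∀ p, R p p = ((∑ j, t j * Complex.normSq (G p j) : ℝ) : ℂ) := by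
      intro p
      rw [hR, Matrix.mul_apply]
      push_cast
      refine Finset.sum_congr rfl fun j _ => ?_
      rw [Matrix.mul_diagonal, conjTranspose_apply, ← Complex.mul_conj, Complex.star_def]
      ring
    have h2 := hx k
    simp only [h1] at h2
    norm_cast at h2
    rw [← h2, Finset.sum_comm]
    simp only [hw, Finset.mul_sum]
  have hx0 : ∀ k, 0 ≤ x k := fun k => by
    rw [← hxw]
    exact Finset.sum_nonneg fun j _ => mul_nonneg (ht j) (hw0 j k)
  -- The convention 0⁻¹ = 0 is harmless: `x k = 0` forces every `t j * w j k` to vanish, by `hxw`.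
  refine ⟨fun j k => t j * w j k * (x k)⁻¹, fun j k =>
    mul_nonneg (mul_nonneg (ht j) (hw0 j k)) (inv_nonneg.2 (hx0 k)), fun j => ?_, fun k => ?_,
    fun j => ?_⟩
  · set q : ℝ := ∑ k, w j k * (x k)⁻¹ with hq
    have hq0 : 0 ≤ q := Finset.sum_nonneg fun k _ => mul_nonneg (hw0 j k) (inv_nonneg.2 (hx0 k))
    have hqp : q = ∑ p : A × B, Complex.normSq (G p j) * (x p.1)⁻¹ := by
      rw [Fintype.sum_prod_type, hq]
      simp only [hw, Finset.sum_mul]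
    -- Test vector (diag(x) ⊗ 1)⁻¹ g_j, with g_j the j-th column of `G`. The form of diag(x) ⊗ 1 at
    -- `v` equals q, and that of `R` is at least t_j q², so t_j q ≤ 1, the wanted row sum.
    set v : A × B → ℂ := fun p => G p j * ((x p.1)⁻¹ : ℝ) with hv
    have hGv : (Gᴴ *ᵥ v) j = (q : ℂ) := by
      rw [hqp, mulVec, dotProduct]
      push_cast
      refine Finset.sum_congr rfl fun p _ => ?_
      rw [conjTranspose_apply, hv, Complex.normSq_eq_conj_mul_self, Complex.star_def]
      push_cast
      ring
    have hD : star v ⬝ᵥ (diagonal (fun p : A × B => (x p.1 : ℂ)) *ᵥ v) = (q : ℂ) := by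
      rw [hqp, dotProduct]
      push_cast
      refine Finset.sum_congr rfl fun p _ => ?_
      rw [mulVec_diagonal, Pi.star_apply, hv, Complex.normSq_eq_conj_mul_self, Complex.star_def,
        map_mul, Complex.conj_ofReal]
      have : ((x p.1 : ℝ) : ℂ)⁻¹ * x p.1 * (x p.1 : ℂ)⁻¹ = (x p.1 : ℂ)⁻¹ := by
        by_cases h : (x p.1 : ℂ) = 0
        · simp [h]
        · field_simp
      push_cast
      linear_combination (starRingEnd ℂ (G p j) * G p j) * this
    have hpos := hle.dotProduct_mulVec_nonneg v
    rw [sub_mulVec, dotProduct_sub, hD, hR, star_dotProduct_conj_diagonal, sub_nonneg] at hpos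
    have hpos' : ∑ i, t i * Complex.normSq ((Gᴴ *ᵥ v) i) ≤ q := by exact_mod_cast hpos
    have hterm : t j * (q * q) ≤ q := by
      refine le_trans ?_ hpos'
      have := Finset.single_le_sum (f := fun i => t i * Complex.normSq ((Gᴴ *ᵥ v) i))
        (fun i _ => mul_nonneg (ht i) (Complex.normSq_nonneg _)) (Finset.mem_univ j)
      simpa only [hGv, Complex.normSq_ofReal] using this
    have hsum : ∑ k, t j * w j k * (x k)⁻¹ = t j * q := by
      rw [hq, Finset.mul_sum]
      exact Finset.sum_congr rfl fun k _ => mul_assoc _ _ _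
    rw [hsum]
    rcases hq0.eq_or_lt with h0 | h0
    · rw [← h0]; norm_num
    · nlinarith
  · rw [← Finset.sum_mul, hxw]
    exact mul_inv_le_one
  · have hterm : ∀ k, x k * (t j * w j k * (x k)⁻¹) = t j * w j k := by
      intro k
      rcases (hx0 k).eq_or_lt with h0 | h0
      · have hz := (Finset.sum_eq_zero_iff_of_nonneg fun j _ => mul_nonneg (ht j) (hw0 j k)).1
          ((hxw k).trans h0.symm) j (Finset.mem_univ j)
        rw [hz]; simp
      · field_simp
    rw [Finset.sum_congr rfl fun k _ => hterm k, ← Finset.mul_sum, hw1, mul_one]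

/-- The spectrum of a bipartite operator dominated by `σ ⊗ 1`, where `σ` is its first marginal, is
majorized by the spectrum of `σ`. -/
theorem sum_decrEig_le_of_le_marginal [DecidableEq A] [DecidableEq B] [DecidableEq J]
    {R : Matrix J J ℂ} (hR : R.PosSemidef) (f : J ≃ A × B) {σ : Matrix A A ℂ}
    (hσ : σ.PosSemidef)
    (hmarg : ∀ a a', σ a a' = ∑ c, R (f.symm (a, c)) (f.symm (a', c)))
    (hle : (σ ⊗ₖ (1 : Matrix B B ℂ) - R.submatrix f.symm f.symm).PosSemidef)
    {K : ℕ} (hKA : K ≤ Fintype.card A) (hKJ : K ≤ Fintype.card J) :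
    ∑ i ∈ Finset.range K, decrEig hR.isHermitian i
      ≤ ∑ i ∈ Finset.range K, decrEig hσ.isHermitian i := by
  have eJ := Fintype.equivFin J
  have eA := Fintype.equivFin A
  obtain ⟨V, hV, hVR⟩ := exists_unitary_diagonal_decrEig hR.isHermitian eJ
  obtain ⟨F, hF, hFσ⟩ := exists_unitary_diagonal_decrEig hσ.isHermitian eA
  set t : J → ℝ := fun j => decrEig hR.isHermitian (eJ j) with ht
  set x : A → ℝ := fun a => decrEig hσ.isHermitian (eA a) with hx
  have hF' : Fᴴ * F = 1 := Matrix.mem_unitaryGroup_iff'.1 hF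
  have hF'' : F * Fᴴ = 1 := Matrix.mem_unitaryGroup_iff.1 hF
  have hV' : Vᴴ * V = 1 := Matrix.mem_unitaryGroup_iff'.1 hV
  -- Rotating the first factor into an eigenbasis of `σ` makes the dominating operator diagonal.
  set L : Matrix (A × B) (A × B) ℂ := F ⊗ₖ (1 : Matrix B B ℂ) with hL
  have hLL : L * Lᴴ = 1 := by
    rw [hL, conjTranspose_kronecker, ← mul_kronecker_mul, hF'']
    simp
  set G : Matrix (A × B) J ℂ := Lᴴ * V.submatrix f.symm id with hG
  have hGG : Gᴴ * G = 1 := by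
    rw [hG, conjTranspose_mul, conjTranspose_conjTranspose, Matrix.mul_assoc,
      ← Matrix.mul_assoc L, hLL, Matrix.one_mul, conjTranspose_submatrix, submatrix_mul_equiv, hV',
      submatrix_id_id]
  have hRG : Lᴴ * R.submatrix f.symm f.symm * L = G * diagonal (fun j => (t j : ℂ)) * Gᴴ := by
    have h1 : R.submatrix f.symm f.symm = V.submatrix f.symm id * diagonal (fun j => (t j : ℂ))
        * (V.submatrix f.symm id)ᴴ := by
      conv_lhs => rw [hVR]
      rfl
    rw [h1, hG, conjTranspose_mul, conjTranspose_conjTranspose]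
    simp only [Matrix.mul_assoc]
  have hσF : Fᴴ * σ * F = diagonal (fun a => (x a : ℂ)) := by
    conv_lhs => rw [hFσ]
    calc Fᴴ * (F * diagonal (fun a => (x a : ℂ)) * Fᴴ) * F
        = (Fᴴ * F) * diagonal (fun a => (x a : ℂ)) * (Fᴴ * F) := by
          simp only [Matrix.mul_assoc]
      _ = _ := by rw [hF', Matrix.one_mul, Matrix.mul_one]
  obtain ⟨D, hD0, hD1, hD2, hD3⟩ := exists_substochastic_of_le_marginal (x := x) hGG
    (fun j => decrEig_nonneg hR (eJ j)) hRG
    (fun k => by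
      have hk := congrFun (congrFun hσF k) k
      rw [diagonal_apply_eq] at hk
      rw [← hk]
      simp only [Matrix.mul_apply, hL, conjTranspose_apply, kroneckerMap_apply, one_apply,
        Fintype.sum_prod_type, submatrix_apply, hmarg, mul_ite, mul_one, mul_zero,
        Finset.sum_ite_eq', Finset.mem_univ, if_true, apply_ite star, star_zero,
        ite_mul, zero_mul, Finset.mul_sum, Finset.sum_mul]
      rw [Finset.sum_comm]
      refine Finset.sum_congr rfl fun a _ => ?_
      rw [Finset.sum_comm])
    (by
      have h1 := hle.conjTranspose_mul_mul_same L
      rw [Matrix.mul_sub, Matrix.sub_mul] at h1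
      convert h1 using 2
      rw [hL, conjTranspose_kronecker, ← mul_kronecker_mul, ← mul_kronecker_mul, hσF]
      ext p p'
      simp [diagonal_apply, kroneckerMap_apply, one_apply, Prod.ext_iff, ite_and]
      split_ifs <;> rfl)
  -- The column sums of `D` over the K largest eigenvalues of `R`. Each is at most 1 by the column
  -- bound, and their total is at most K by the row bound.
  set q : ℕ → ℝ := fun k => if h : k < Fintype.card A then
    ∑ j with (eJ j : ℕ) < K, D j (eA.symm ⟨k, h⟩) else 0 with hq
  have hqA : ∀ a, q (eA a) = ∑ j with (eJ j : ℕ) < K, D j a := by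
    intro a
    simp [hq]
  have hcard : (Finset.univ.filter fun j => (eJ j : ℕ) < K).card = K := by
    rw [← Finset.card_map eJ.toEmbedding]
    have : (Finset.univ.filter fun j => (eJ j : ℕ) < K).map eJ.toEmbedding
        = Finset.univ.filter fun i : Fin (Fintype.card J) => (i : ℕ) < K := by
      ext i
      simp
    rw [this, Fin.card_filter_val_lt, min_eq_right hKJ]
  have hsumt : ∑ i ∈ Finset.range K, decrEig hR.isHermitian i
      = ∑ k ∈ Finset.range (Fintype.card A), decrEig hσ.isHermitian k * q k := by
    rw [← sum_comp_equiv_fin_card eA fun k => decrEig hσ.isHermitian k * q k]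
    simp only [hqA, Finset.mul_sum]
    rw [Finset.sum_comm]
    rw [Finset.sum_congr rfl fun j _ => hD3 j, Finset.sum_filter]
    rw [sum_comp_equiv_fin_card eJ fun i => if i < K then decrEig hR.isHermitian i else 0,
      ← Finset.sum_filter]
    refine Finset.sum_congr ?_ fun _ _ => rfl
    ext i
    simp only [Finset.mem_filter, Finset.mem_range]
    omega
  rw [hsumt]
  refine sum_mul_le_sum_range_of_weights hKA (fun j k hjk hk => decrEig_anti _ hjk hk)
    (fun k _ => decrEig_nonneg hσ k) (fun k hk => ?_) (fun k hk => ?_) ?_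
  · simp only [hq, dif_pos hk]
    exact Finset.sum_nonneg fun j _ => hD0 _ _
  · simp only [hq, dif_pos hk]
    exact (Finset.sum_le_sum_of_subset_of_nonneg (Finset.filter_subset _ _)
      fun j _ _ => hD0 _ _).trans (hD2 _)
  · rw [← sum_comp_equiv_fin_card eA q]
    simp only [hqA]
    rw [Finset.sum_comm]
    refine (Finset.sum_le_sum fun j _ => hD1 j).trans ?_
    rw [Finset.sum_const, hcard, nsmul_eq_mul, mul_one]

end Majorization

/-! ### The reduction criterion and separable states -/

section Separable

variable {ι : Type} [Fintype ι] [DecidableEq ι]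

/-- The complement of an orthogonal projection is itself one, hence of the form Q†Q. -/
theorem posSemidef_one_sub_proj {n : Type} [Fintype n] [DecidableEq n] {φ : n → ℂ}
    (hφ : ∑ c, ‖φ c‖ ^ 2 = 1) : (1 - proj φ).PosSemidef := by
  have hdot : star φ ⬝ᵥ φ = 1 := by
    rw [dotProduct]
    simp only [Pi.star_apply, Complex.star_def, Complex.conj_mul']
    exact_mod_cast hφ
  have hsq : proj φ * proj φ = proj φ := by
    rw [proj, vecMulVec_mul_vecMulVec, hdot, one_smul]
  have hherm : (proj φ)ᴴ = proj φ := by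
    rw [proj, conjTranspose_vecMulVec, star_star]
  have h := posSemidef_conjTranspose_mul_self (1 - proj φ)
  rwa [conjTranspose_sub, conjTranspose_one, hherm, Matrix.sub_mul, Matrix.mul_sub, Matrix.mul_sub,
    hsq, Matrix.one_mul, Matrix.one_mul, Matrix.mul_one, sub_self, sub_zero] at h

/-- The reduction criterion for separable states: `ρ ≤ ρ_X ⊗ 1`. -/
theorem State.IsSeparableAcross.le_marginal {ρ : State ι} {X : Finset ι}
    (hρ : ρ.IsSeparableAcross X) :
    ((ρ.marginal X).mat ⊗ₖ (1 : Op {l // l ∉ X})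
      - ρ.mat.submatrix (split X).symm (split X).symm).PosSemidef := by
  obtain ⟨k, p, ψ, φ, hp, -, -, hφ, h⟩ := hρ
  have hmat : ρ.mat.submatrix (split X).symm (split X).symm
      = ∑ i, (p i : ℂ) • (proj (ψ i) ⊗ₖ proj (φ i)) := by
    rw [h]
    ext a b
    simp [Matrix.sum_apply]
  have hmarg : (ρ.marginal X).mat = ∑ i, (p i : ℂ) • proj (ψ i) := by
    ext a b
    have hone : ∀ i, ∑ c, proj (φ i) c c = 1 := by
      intro i
      simp only [proj, vecMulVec_apply, Pi.star_apply, Complex.star_def, Complex.mul_conj']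
      exact_mod_cast hφ i
    simp only [State.marginal, h, Matrix.sum_apply, submatrix_apply, Matrix.smul_apply,
      Equiv.apply_symm_apply, kroneckerMap_apply]
    rw [Finset.sum_comm]
    refine Finset.sum_congr rfl fun i _ => ?_
    rw [← Finset.smul_sum, ← Finset.mul_sum, hone, mul_one]
  have hdiff : (ρ.marginal X).mat ⊗ₖ (1 : Op {l // l ∉ X})
      - ρ.mat.submatrix (split X).symm (split X).symm
      = ∑ i, (p i : ℂ) • (proj (ψ i) ⊗ₖ (1 - proj (φ i))) := by
    rw [hmat, hmarg]
    ext a b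
    simp only [Matrix.sub_apply, Matrix.sum_apply, Matrix.smul_apply, kroneckerMap_apply,
      Finset.sum_mul, smul_eq_mul, ← Finset.sum_sub_distrib]
    refine Finset.sum_congr rfl fun i _ => ?_
    ring
  rw [hdiff]
  refine Matrix.posSemidef_sum _ fun i _ => Matrix.PosSemidef.smul ?_ ?_
  · exact (posSemidef_vecMulVec_self_star (ψ i)).kronecker (posSemidef_one_sub_proj (hφ i))
  · exact_mod_cast hp i

/-- A separable state is more disordered globally than locally (Nielsen–Kempe). -/
theorem State.IsSeparableAcross.sum_spec_le {ρ : State ι} {X : Finset ι}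
    (hρ : ρ.IsSeparableAcross X) {K : ℕ} (hK : K ≤ Fintype.card (Config {l // l ∈ X})) :
    ∑ i ∈ Finset.range K, ρ.spec i ≤ ∑ i ∈ Finset.range K, (ρ.marginal X).spec i := by
  refine sum_decrEig_le_of_le_marginal ρ.posSemidef (split X) (ρ.marginal X).posSemidef
    (fun a a' => ?_) hρ.le_marginal hK (hK.trans ?_)
  · simp [State.marginal, Matrix.sum_apply]
  · rw [Fintype.card_congr (split X), Fintype.card_prod]
    exact Nat.le_mul_of_pos_right _ Fintype.card_pos

end Separable

end QubitErgotropy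

namespace QubitErgotropy

/-! ### Energies of non-interacting qubits and the formula for Δ -/

section Energy

variable {ι : Type} [Fintype ι] [DecidableEq ι]

/-- The energy of a computational basis state. -/
def level (E α : ι → ℝ) (s : Config ι) : ℝ := ∑ l, (E l + (s l : ℕ) * α l)

theorem hamiltonian_eq_diagonal (E α : ι → ℝ) :
    hamiltonian E α = diagonal fun s => (level E α s : ℂ) := by
  ext s t
  simp only [hamiltonian, tensorOp, Matrix.sum_apply, Matrix.of_apply]
  by_cases hst : s = t
  · subst hst
    rw [diagonal_apply_eq, level]
    push_cast
    refine Finset.sum_congr rfl fun l _ => ?_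
    rw [Finset.prod_eq_single l]
    · simp [qubitHamiltonian]
    · intro k _ hk
      simp [Function.update_of_ne hk]
    · simp
  · rw [diagonal_apply_ne _ hst]
    obtain ⟨k, hk⟩ := Function.ne_iff.1 hst
    refine Finset.sum_eq_zero fun l _ => Finset.prod_eq_zero (Finset.mem_univ k) ?_
    rcases eq_or_ne k l with rfl | h
    · simp [qubitHamiltonian, diagonal_apply_ne _ hk]
    · simp [Function.update_of_ne h, one_apply_ne hk]

theorem energy_hamiltonian (E α : ι → ℝ) (ρ : Op ι) :
    energy (hamiltonian E α) ρ = ∑ s, (ρ s s).re * level E α s := by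
  rw [energy, hamiltonian_eq_diagonal, Matrix.trace, Complex.re_sum]
  refine Finset.sum_congr rfl fun s _ => ?_
  rw [diag_apply, mul_diagonal, Complex.re_mul_ofReal]

theorem sum_eq_sum_mem_add_sum_notMem (X : Finset ι) (f : ι → ℝ) :
    ∑ l, f l = (∑ l : {l // l ∈ X}, f l) + ∑ l : {l // l ∉ X}, f l := by
  convert (Fintype.sum_subtype_add_sum_subtype (fun l => l ∈ X) f).symm

theorem level_split_symm (E α : ι → ℝ) (X : Finset ι) (a : Config {l // l ∈ X})
    (c : Config {l // l ∉ X}) :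
    level E α ((split X).symm (a, c))
      = level (fun l : {l // l ∈ X} => E l) (fun l => α l) a
        + level (fun l : {l // l ∉ X} => E l) (fun l => α l) c := by
  simp only [level]
  rw [sum_eq_sum_mem_add_sum_notMem X]
  congr 1 <;> refine Finset.sum_congr rfl fun l _ => ?_
  · simp [split, Equiv.piEquivPiSubtypeProd, l.2]
  · simp [split, Equiv.piEquivPiSubtypeProd, l.2]

/-- The energy of non-interacting subsystems is the sum of their local energies. -/
theorem energy_eq_add_marginals (E α : ι → ℝ) (X : Finset ι) (ρ : State ι) :
    energy (hamiltonian E α) ρ.mat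
      = energy (hamiltonian (fun l : {l // l ∈ X} => E l) (fun l => α l)) (ρ.marginal X).mat
        + energy (hamiltonian (fun l : {l // l ∉ X} => E l) (fun l => α l))
          (ρ.marginalCompl X).mat := by
  simp only [energy_hamiltonian, State.marginal, State.marginalCompl, Matrix.sum_apply,
    submatrix_apply, Complex.re_sum, Finset.sum_mul]
  rw [← Equiv.sum_comp (split X).symm, Fintype.sum_prod_type]
  simp only [level_split_symm, mul_add, Finset.sum_add_distrib]
  congr 1
  rw [Finset.sum_comm]

theorem gap_zero (E : ι → ℝ) {α : ι → ℝ} (hα : ∀ l, 0 ≤ α l) : gap E α 0 = 0 := by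
  rw [gap, incrEig_zero_diagonal _ (hamiltonian_eq_diagonal E α) (i₀ := fun _ => 0)]
  · simp [level, groundEnergy]
  · intro s
    refine Finset.sum_le_sum fun l _ => ?_
    have := mul_nonneg (Nat.cast_nonneg (α := ℝ) (s l : ℕ)) (hα l)
    simpa using this

theorem gap_last (E : ι → ℝ) {α : ι → ℝ} (hα : ∀ l, 0 ≤ α l) :
    gap E α (Fintype.card (Config ι) - 1) = ∑ l, α l := by
  rw [gap, incrEig_last_diagonal _ (hamiltonian_eq_diagonal E α) (i₀ := fun _ => 1)]
  · simp [level, groundEnergy, Finset.sum_add_distrib]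
  · intro s
    refine Finset.sum_le_sum fun l _ => ?_
    have h1 : ((s l : ℕ) : ℝ) ≤ 1 := by exact_mod_cast Nat.lt_succ_iff.1 (s l).2
    have := mul_le_mul_of_nonneg_right h1 (hα l)
    simpa using this

theorem gap_mono (E α : ι → ℝ) {j k : ℕ} (hjk : j ≤ k) (hk : k < Fintype.card (Config ι)) :
    gap E α j ≤ gap E α k :=
  sub_le_sub_right (incrEig_mono _ hjk hk) _

theorem State.sum_spec (ρ : State ι) :
    ∑ j ∈ Finset.range (Fintype.card (Config ι)), ρ.spec j = 1 := by
  have := sum_decrEig ρ.posSemidef.isHermitian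
  rw [ρ.trace_eq_one, Complex.one_re] at this
  exact this

theorem State.minEnergy_eq (E α : ι → ℝ) (ρ : State ι) :
    minEnergy (hamiltonian E α) ρ.mat = groundEnergy E
      + ∑ j ∈ Finset.range (Fintype.card (Config ι)), gap E α j * ρ.spec j := by
  rw [minEnergy_eq_sum (hamiltonian_isHermitian E α) ρ.posSemidef.isHermitian]
  simp only [gap, sub_mul, Finset.sum_sub_distrib, ← Finset.mul_sum, ρ.sum_spec, mul_one,
    add_sub_cancel]
  exact Finset.sum_congr rfl fun j _ => mul_comm _ _

/-- Additivity cancels the mean energies and the ground energies, leaving only passive-state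
energies. -/
theorem workDifference_eq (E α : ι → ℝ) (X : Finset ι) (ρ : State ι) :
    workDifference E α X ρ
      = (∑ j ∈ Finset.range (Fintype.card (Config {l // l ∈ X})),
          gap (fun l : {l // l ∈ X} => E l) (fun l => α l) j * (ρ.marginal X).spec j)
        - ∑ j ∈ Finset.range (Fintype.card (Config ι)), gap E α j * ρ.spec j := by
  rw [workDifference, ergotropy, ergotropy, energy_eq_add_marginals E α X, State.minEnergy_eq,
    State.minEnergy_eq, groundEnergy, sum_eq_sum_mem_add_sum_notMem X E]
  simp only [groundEnergy]
  ring

end Energy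

/-! ### From majorization to the two bounds -/

section Bounds

theorem sum_range_eq_add_sum_Icc (f : ℕ → ℝ) {d : ℕ} (hd : 0 < d) :
    ∑ i ∈ Finset.range d, f i = f 0 + ∑ i ∈ Finset.Icc 1 (d - 1), f i := by
  obtain ⟨d, rfl⟩ := Nat.exists_eq_succ_of_ne_zero hd.ne'
  rw [Finset.sum_range_succ', add_comm, Finset.range_eq_Ico, Finset.sum_Ico_add' f 0 d 1]
  rfl

/-- By normalization the right side minus the left is exactly m₁ (x₀ - t₀). -/
theorem sum_sub_sum_le_of_largest_le {d M : ℕ} (hd : 0 < d) (hM : 0 < M) {m n x t : ℕ → ℝ}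
    (hm0 : m 0 = 0) (hn0 : n 0 = 0) (hm1 : 0 ≤ m 1)
    (hx : ∑ i ∈ Finset.range d, x i = 1) (ht : ∑ i ∈ Finset.range M, t i = 1)
    (h : t 0 ≤ x 0) :
    ∑ i ∈ Finset.range d, m i * x i - ∑ i ∈ Finset.range M, n i * t i
      ≤ ∑ i ∈ Finset.Icc 1 (d - 1), (m i - m 1) * x i
        + ∑ i ∈ Finset.Icc 1 (M - 1), (m 1 - n i) * t i := by
  rw [sum_range_eq_add_sum_Icc _ hd] at hx ⊢
  rw [sum_range_eq_add_sum_Icc _ hM] at ht ⊢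
  simp only [sub_mul, Finset.sum_sub_distrib, ← Finset.mul_sum, hm0, hn0, zero_mul, zero_add]
  nlinarith [mul_le_mul_of_nonneg_left h hm1]

/-- Abel summation gives ∑_{i<d} mᵢ (xᵢ - tᵢ) ≤ m_{d-1} (1 - ∑_{i<d} tᵢ), and the bracket is the
tail ∑_{i≥d} tᵢ. For d = 2 the first sum on the right is empty. -/
theorem sum_sub_sum_le_of_majorized {d M : ℕ} (hd : 2 ≤ d) (hdM : d ≤ M) {m n x t : ℕ → ℝ}
    (hm0 : m 0 = 0) (hn0 : n 0 = 0) (hm : ∀ j k, j ≤ k → k < d → m j ≤ m k)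
    (hx : ∑ i ∈ Finset.range d, x i = 1) (ht : ∑ i ∈ Finset.range M, t i = 1)
    (h : ∀ K ≤ d, ∑ i ∈ Finset.range K, t i ≤ ∑ i ∈ Finset.range K, x i) :
    ∑ i ∈ Finset.range d, m i * x i - ∑ i ∈ Finset.range M, n i * t i
      ≤ ∑ i ∈ Finset.Icc 1 (d - 2), (m i - n i) * t i
        + ∑ i ∈ Finset.Icc (d - 1) (M - 1), (m (d - 1) - n i) * t i := by
  have habel := sum_mul_le_mul_sum_of_monotone (m := m) (y := fun i => x i - t i) (d - 1)
    (fun j hj => hm j (j + 1) (by omega) (by omega))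
    (fun j hj => by rw [Finset.sum_sub_distrib]; exact sub_nonneg.2 (h j (by omega)))
  rw [show d - 1 + 1 = d by omega] at habel
  simp only [mul_sub, Finset.sum_sub_distrib, hx] at habel
  have hsplit : ∀ f : ℕ → ℝ, ∑ i ∈ Finset.range M, f i
      = ∑ i ∈ Finset.range (d - 1), f i + ∑ i ∈ Finset.Icc (d - 1) (M - 1), f i := by
    intro f
    have hIcc : Finset.Icc (d - 1) (M - 1) = Finset.Ico (d - 1) M := by
      ext i; simp only [Finset.mem_Icc, Finset.mem_Ico]; omega
    rw [hIcc, Finset.sum_range_add_sum_Ico _ (by omega)]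
  have hhead : ∀ f : ℕ → ℝ, ∑ i ∈ Finset.range (d - 1), f i
      = f 0 + ∑ i ∈ Finset.Icc 1 (d - 2), f i := fun f =>
    sum_range_eq_add_sum_Icc f (by omega)
  have hlast : ∀ f : ℕ → ℝ, ∑ i ∈ Finset.range d, f i
      = ∑ i ∈ Finset.range (d - 1), f i + f (d - 1) := by
    intro f
    rw [← Finset.sum_range_succ, show d - 1 + 1 = d by omega]
  rw [hlast (fun i => m i * t i), hlast t, hhead (fun i => m i * t i), hhead t] at habel
  rw [hsplit, hhead] at ht
  rw [hsplit (fun i => n i * t i), hhead (fun i => n i * t i)]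
  simp only [sub_mul, Finset.sum_sub_distrib, ← Finset.mul_sum, hm0, hn0, zero_mul, zero_add]
    at habel ⊢
  have hm1 := congrArg (m (d - 1) * ·) ht
  linarith

end Bounds

end QubitErgotropy

theorem theorem1 (N κ : ℕ) (E α : Fin N → ℝ) (hα : ∀ l, 0 ≤ α l)
    (X : Finset (Fin N)) (hX : X.card = κ) (hκ : 1 ≤ κ) (hκN : κ < N)
    (ρ : QubitErgotropy.State (Fin N)) (hρ : ρ.IsSeparableAcross X)
    (t x n m : ℕ → ℝ)
    (ht : t = ρ.spec) (hx : x = (ρ.marginal X).spec)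
    (hn : n = QubitErgotropy.gap E α)
    (hm : m = QubitErgotropy.gap (fun l : {l // l ∈ X} => E l) (fun l => α l)) :
    QubitErgotropy.workDifference E α X ρ
        ≤ ∑ i ∈ Finset.Icc 1 (2 ^ κ - 1), (m i - m 1) * x i
          + ∑ i ∈ Finset.Icc 1 (2 ^ N - 1), (m 1 - n i) * t i ∧
    QubitErgotropy.workDifference E α X ρ
        ≤ ∑ i ∈ Finset.Icc 1 (2 ^ κ - 2), (m i - n i) * t i
          + ∑ i ∈ Finset.Icc (2 ^ κ - 1) (2 ^ N - 1), (m (2 ^ κ - 1) - n i) * t i ∧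
    m (2 ^ κ - 1) = ∑ l ∈ X, α l := by
  subst ht hx hn hm
  have hd : Fintype.card (QubitErgotropy.Config {l // l ∈ X}) = 2 ^ κ := by
    simp [QubitErgotropy.Config, hX]
  have hM : Fintype.card (QubitErgotropy.Config (Fin N)) = 2 ^ N := by
    simp [QubitErgotropy.Config]
  have hd2 : 2 ≤ 2 ^ κ := by simpa using Nat.pow_le_pow_right (n := 2) (by norm_num) hκ
  have hdM : 2 ^ κ ≤ 2 ^ N := Nat.pow_le_pow_right (by norm_num) hκN.le
  have hαX : ∀ l : {l // l ∈ X}, 0 ≤ α l := fun l => hα l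
  have hm0 := QubitErgotropy.gap_zero (fun l : {l // l ∈ X} => E l) hαX
  have hn0 := QubitErgotropy.gap_zero E hα
  have hmono : ∀ j k, j ≤ k → k < 2 ^ κ → _ ≤ _ := fun j k hjk hk =>
    QubitErgotropy.gap_mono (fun l : {l // l ∈ X} => E l) (fun l => α l) hjk (hd ▸ hk)
  have hxs := (ρ.marginal X).sum_spec
  have hts := ρ.sum_spec
  have hmaj : ∀ K ≤ 2 ^ κ, _ ≤ _ := fun K hK => hρ.sum_spec_le (hd ▸ hK)
  rw [QubitErgotropy.workDifference_eq]
  rw [hd] at hxs ⊢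
  rw [hM] at hts ⊢
  -- t₀ ≤ x₀ is the partial-sum inequality for K = 1.
  refine ⟨QubitErgotropy.sum_sub_sum_le_of_largest_le (by omega) (by omega) hm0 hn0
      (hm0 ▸ hmono 0 1 zero_le_one (by omega)) hxs hts (by simpa using hmaj 1 (by omega)),
    QubitErgotropy.sum_sub_sum_le_of_majorized hd2 hdM hm0 hn0 hmono hxs hts hmaj, ?_⟩
  rw [← hd, QubitErgotropy.gap_last _ hαX]
  exact Finset.sum_coe_sort X α
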